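/- **Conventions.** "Compact space" means compact, second-countable, Hausdorff. Identify $\{0,1\}^n$ with $\mathbb F_2^n$, and the set of finitely supported sequences $\{0,1\}^{(\mathbb N)}$ with $\mathbb F_2^\omega=\bigoplus_{i\in\mathbb N}\mathbb F_2$; also view $\mathbb F_2^n\subset\mathbb F_2^\omega$ via $v\mapsto(v,0,0,\dots)$. $\mathcal P(Y)$ denotes the set of Borel probability measures on $Y$, with the $\sigma$-algebra generated by the evaluations $\mu\mapsto\mu(S)$. **Nilspaces.** A *discrete-cube morphism* $\{0,1\}^n\to\{0,1\}^m$ is a map each of whose coordinates is constant, or equal to $v_i$ or $1-v_i$ for some $i$; it is a *face map* if it is injective and exactly $m-n$ coordinates are constant. A *nilspace* is a nonempty set $X$ with cube sets $C^n(X)\subset X^{\{0,1\}^n}$ such that: $q\circ\phi\in C^n(X)$ for all $q\in C^m(X)$ and all discrete-cube morphisms $\phi:\{0,1\}^n\to\{0,1\}^m$; $C^1(X)=X^{\{0,1\}}$; and every *$n$-corner* ($n\ge1$), i.e. map on $\{0,1\}^n\setminus\{1^n\}$ whose composition with every face map $\{0,1\}^{n-1}\to\{0,1\}^n$ missing $1^n$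 is in $C^{n-1}(X)$, extends to (is *completed* by) an element of $C^n(X)$. It is *$k$-step* if completions of $(k+1)$-corners are unique. A *morphism* is a map sending cubes to cubes; a *fibration* is a morphism $\varphi:X\to Y$ such that for every corner $q'$ on $X$ every completion of $\varphi\circ q'$ is $\varphi\circ q$ for some completion $q$ of $q'$. A *compact nilspace* is a nilspace with a compact topology for which all cube sets are closed; it is *profinite-step* if it is the inverse limit of a sequence of finite-step compact nilspaces with continuous fibrations as bonding maps. For an abelian group $A$, $\mathcal D_k(A)$ is $A$ with $C^n$ the set of $q:\{0,1\}^n\to A$ such that $\sum_{v\in\{0,1\}^{k+1}}(-1)^{v_1+\dots+v_{k+1}}q(\phi(v))=0$ for every face map $\phi:\{0,1\}^{k+1}\to\{0,1\}^n$. $X$ is *2-homogeneous* if for every $n$ and every morphism $f:\mathcal D_1(\mathbb Z^n)\to X$, the restriction $f|_{\{0,1\}^n}$ is a morphism $\mathcal D_1(\mathbb F_2^n)\to X$. **Haar measure and $\zeta_{X,m}$.** Write $x\sim_k y$ if there are $q_1,q_2\in C^{k+1}(X)$ which agree off $1^{k+1}$ and take the values $x$ and $y$ at $1^{k+1}$;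 let $\pi_k:X\to X_k=X/{\sim_k}$, with cubes the images of cubes of $X$. For $k\ge 1$ the $k$-th structure group $Z_k$ of a compact nilspace $X$ is the compact abelian group acting continuously and freely on $X_k$ with orbits the fibres of $X_k\to X_{k-1}$, such that for each $q\in C^n(X_k)$ and $g:\{0,1\}^n\to Z_k$, the map $q+g$ is in $C^n(X_k)$ if and only if $g\in C^n(\mathcal D_k(Z_k))$. Let $C^\omega(X)\subset X^{\mathbb F_2^\omega}$ be the set of maps whose restriction to each $\{0,1\}^n$ is in $C^n(X)$. For a compact profinite-step nilspace $X$, the Haar measure $\mu_{C^\omega(X)}$ is the unique Borel probability measure on $C^\omega(X)$ whose image on $C^\omega(X_k)$ under composition with $\pi_k$ is, for every $k\ge1$, invariant under the action of $C^\omega(\mathcal D_k(Z_k))$ by pointwise translation. For a Borel map $m:X\to\mathcal P(B)$ put $$\zeta_{X,m}=\int_{C^\omega(X)}\ \prod_{v\in\mathbb F_2^\omega} m(q(v))\ d\mu_{C^\omega(X)}(q)\in\mathcal P(B^{\mathbb F_2^\omega}).$$ **Affine exchangeability.** $\mu\in\mathcal P(B^{\mathbb F_2^\omega})$ is *affine-exchangeable*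 if it is invariant under the coordinate permutations induced by all invertible affine maps of $\mathbb F_2^\omega$. A *finite face* with finite set $S\subset\mathbb N$ of free coordinates is a set $\{v\in\mathbb F_2^\omega: v_i=z_i\ \forall i\notin S\}$, for some $z\in\mathbb F_2^\omega$. $\mu$ has the *independence property* if for any two disjoint finite faces with disjoint sets of free coordinates, the $\sigma$-algebras generated by the coordinates in the two faces are $\mu$-independent. **Convergence.** For $f:\mathbb F_2^n\to B$ and a finite set $L\subset\mathbb F_2^k\subset\mathbb F_2^\omega$, let $\mu_{L,f}\in\mathcal P(B^L)$ be the law of $(f(A(v)))_{v\in L}$ where $A:\mathbb F_2^k\to\mathbb F_2^n$ is a uniformly random affine map (this does not depend on $k$). A sequence $(f_n:\mathbb F_2^n\to B)_{n}$ is *convergent* if for every finite $L\subset\mathbb F_2^\omega$ the measures $\mu_{L,f_n}$ converge vaguely as $n\to\infty$. **Theorem.** Let $X$ be a compact profinite-step 2-homogeneous nilspace and let $B$ be a compact metric space. The following are equivalent. 1. For every affine-exchangeable $\mu\in\mathcal P(B^{\mathbb F_2^\omega})$ with the independence property there is a Borel map $m:X\to\mathcal P(B)$ such that $\mu=\zeta_{X,m}$.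 2. For every convergent sequence $(f_n:\mathbb F_2^n\to B)_n$ there is a Borel map $m:X\to\mathcal P(B)$ such that for every finite $L\subset\mathbb F_2^\omega$ the measures $\mu_{L,f_n}$ converge vaguely to the image of $\zeta_{X,m}$ under the coordinate projection $B^{\mathbb F_2^\omega}\to B^L$. -/

import Mathlib

open MeasureTheory ProbabilityTheory Filter Topology

universe u v w

/-! ## Discrete cubes

The discrete cube `{0,1}^n` is identified with `𝔽₂ⁿ` and written `Fin n → ZMod 2`; the infinite
discrete cube (finitely supported 0-1 sequences) is identified with `𝔽₂^ω` and written
`ℕ →₀ ZMod 2`. -/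

/-- The discrete cube `{0,1}^n`, identified with `𝔽₂ⁿ`. -/
abbrev DCube (n : ℕ) : Type := Fin n → ZMod 2

/-- The infinite discrete cube, identified with `𝔽₂^ω`, the direct sum of copies of `𝔽₂`. -/
abbrev F2w : Type := ℕ →₀ ZMod 2

/-- Discrete-cube morphisms: each output coordinate is `0`, `1`, `v i` or `1 - v i`. -/
def IsDCubeMorphism {n m : ℕ} (φ : DCube n → DCube m) : Prop :=
  ∀ j : Fin m, (∃ c : ZMod 2, ∀ v, φ v j = c) ∨
    ∃ i : Fin n, (∀ v, φ v j = v i) ∨ (∀ v, φ v j = 1 - v i)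

/-- Face maps: injective discrete-cube morphisms with exactly `m - n` constant coordinates. -/
def IsFaceMap {n m : ℕ} (φ : DCube n → DCube m) : Prop :=
  IsDCubeMorphism φ ∧ Function.Injective φ ∧
    Nat.card {j : Fin m // ∀ v w, φ v j = φ w j} + n = m

/-- The inclusion `v ↦ (v, 0, 0, …)` of `𝔽₂ⁿ` in `𝔽₂^ω`. -/
noncomputable def embedCube (n : ℕ) (v : DCube n) : F2w :=
  (Finsupp.equivFunOnFinite.symm v).embDomain Fin.valEmbedding

/-! ## Nilspaces -/

/-- A set with a designated collection of `n`-cubes for each `n`. -/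
class Cubespace (X : Type u) where
  cubes : ∀ n : ℕ, Set (DCube n → X)

open Cubespace (cubes)

/-- The `n`-corner condition. A corner is a map on the cube minus the vertex `1ⁿ`; it is given
here by a map on the whole cube whose value at `1ⁿ` plays no role. -/
def IsNilCorner {X : Type u} [Cubespace X] {n : ℕ} (q : DCube (n + 1) → X) : Prop :=
  ∀ φ : DCube n → DCube (n + 1), IsFaceMap φ → (∀ v, φ v ≠ 1) → q ∘ φ ∈ cubes n

/-- `q` completes the corner `q'`. -/
def Completes {X : Type u} [Cubespace X] {n : ℕ} (q q' : DCube n → X) : Prop :=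
  q ∈ cubes n ∧ ∀ v, v ≠ 1 → q v = q' v

/-- The nilspace axioms. -/
class IsNilspace (X : Type u) [Cubespace X] : Prop where
  nonempty : Nonempty X
  composition : ∀ (n m : ℕ) (φ : DCube n → DCube m), IsDCubeMorphism φ →
    ∀ q ∈ cubes (X := X) m, q ∘ φ ∈ cubes n
  ergodicity : cubes (X := X) 1 = Set.univ
  completion : ∀ (n : ℕ) (q' : DCube (n + 1) → X), IsNilCorner q' → ∃ q, Completes q q'

/-- A `k`-step nilspace: completions of `(k+1)`-corners are unique. -/
def IsStep (k : ℕ) (X : Type u) [Cubespace X] : Prop :=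
  ∀ q' q₁ q₂ : DCube (k + 1) → X, IsNilCorner q' → Completes q₁ q' → Completes q₂ q' → q₁ = q₂

/-- A compact nilspace: a nilspace with a compact, second-countable, Hausdorff topology for which
the cube sets are closed. -/
class IsCompactNilspace (X : Type u) [TopologicalSpace X] [Cubespace X] : Prop
    extends IsNilspace X, CompactSpace X, T2Space X, SecondCountableTopology X where
  isClosed_cubes : ∀ n, IsClosed (cubes (X := X) n)

/-- Nilspace morphisms (the continuity of morphisms of compact nilspaces is stated separately). -/
def IsNilMorphism {X : Type u} {Y : Type v} [Cubespace X] [Cubespace Y] (φ : X → Y) : Prop :=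
  ∀ n, ∀ q ∈ cubes (X := X) n, φ ∘ q ∈ cubes n

/-- Fibrations: every completion of the image of a corner lifts to a completion of the corner. -/
def IsFibration {X : Type u} {Y : Type v} [Cubespace X] [Cubespace Y] (φ : X → Y) : Prop :=
  IsNilMorphism φ ∧ ∀ (n : ℕ) (q' : DCube (n + 1) → X), IsNilCorner q' →
    ∀ q : DCube (n + 1) → Y, Completes q (φ ∘ q') → ∃ r, Completes r q' ∧ φ ∘ r = q

/-- Profinite-step: `X` is the inverse limit (as a topological space and as a cubespace) of an
inverse sequence of finite-step compact nilspaces `Y i` with continuous fibrations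
`φ i : Y (i+1) → Y i` as bonding maps; `p i` are the limit maps. The bijection with the
inverse limit is automatically a homeomorphism for compact `X`. -/
def IsProfiniteStep (X : Type u) [TopologicalSpace X] [Cubespace X] : Prop :=
  ∃ (Y : ℕ → Type u) (_ : ∀ i, TopologicalSpace (Y i)) (_ : ∀ i, Cubespace (Y i))
    (φ : ∀ i, Y (i + 1) → Y i) (p : ∀ i, X → Y i),
    (∀ i, IsCompactNilspace (Y i) ∧ ∃ k, IsStep k (Y i)) ∧
    (∀ i, Continuous (φ i) ∧ IsFibration (φ i)) ∧
    (∀ i, Continuous (p i)) ∧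
    (∀ i x, φ i (p (i + 1) x) = p i x) ∧
    (∀ y : ∀ i, Y i, (∀ i, φ i (y (i + 1)) = y i) → ∃! x, ∀ i, p i x = y i) ∧
    (∀ n (q : DCube n → X), q ∈ cubes n ↔ ∀ i, p i ∘ q ∈ cubes n)

/-- The nilspace `𝒟ₖ(A)` on an abelian group `A`. -/
def DegSpace (_k : ℕ) (A : Type u) : Type u := A

instance (k : ℕ) (A : Type u) [AddCommGroup A] : AddCommGroup (DegSpace k A) :=
  inferInstanceAs (AddCommGroup A)

/-- The alternating sum `σₙ(f) = ∑ (-1)^{v(1)+⋯+v(n)} f(v)`. -/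
def altSum {A : Type u} [AddCommGroup A] {n : ℕ} (f : DCube n → A) : A :=
  ∑ v : DCube n, ((-1 : ℤ) ^ (∑ i, (v i).val)) • f v

/-- A map is an `n`-cube of `𝒟ₖ(A)` if its alternating sum vanishes on all `(k+1)`-faces. -/
instance (k : ℕ) (A : Type u) [AddCommGroup A] : Cubespace (DegSpace k A) where
  cubes n := {q | ∀ φ : DCube (k + 1) → DCube n, IsFaceMap φ → altSum (q ∘ φ) = 0}

/-- 2-homogeneous nilspaces: the restriction to `{0,1}ⁿ` of any morphism `𝒟₁(ℤⁿ) → X` is a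
morphism `𝒟₁(𝔽₂ⁿ) → X`. -/
def IsTwoHomogeneous (X : Type u) [Cubespace X] : Prop :=
  ∀ (n : ℕ) (f : DegSpace 1 (Fin n → ℤ) → X), IsNilMorphism f →
    IsNilMorphism (X := DegSpace 1 (Fin n → ZMod 2))
      (fun v : Fin n → ZMod 2 => f (fun i => ((v i).val : ℤ)))

/-! ## Characteristic factors and structure groups -/

/-- The relation `x ∼ₖ y`. -/
def CharRel (X : Type u) [Cubespace X] (k : ℕ) (x y : X) : Prop :=
  ∃ q₁ ∈ cubes (X := X) (k + 1), ∃ q₂ ∈ cubes (X := X) (k + 1),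
    (∀ v, v ≠ 1 → q₁ v = q₂ v) ∧ q₁ 1 = x ∧ q₂ 1 = y

/-- The `k`-th characteristic factor `Xₖ = X/∼ₖ`. -/
def CharFactor (X : Type u) [Cubespace X] (k : ℕ) : Type u := Quot (CharRel X k)

/-- The projection `πₖ : X → Xₖ`. -/
def charProj (X : Type u) [Cubespace X] (k : ℕ) : X → CharFactor X k := Quot.mk _

/-- The cubes on `Xₖ` are the images of the cubes on `X`. -/
instance (X : Type u) [Cubespace X] (k : ℕ) : Cubespace (CharFactor X k) where
  cubes n := {c | ∃ q ∈ cubes (X := X) n, c = charProj X k ∘ q}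

instance (X : Type u) [Cubespace X] [TopologicalSpace X] (k : ℕ) :
    TopologicalSpace (CharFactor X k) :=
  inferInstanceAs (TopologicalSpace (Quot (CharRel X k)))

instance (X : Type u) [Cubespace X] [TopologicalSpace X] (k : ℕ) :
    MeasurableSpace (CharFactor X k) := borel _

/-- `A` is (with the given action) the `(k+1)`-st structure group of `X`: a compact abelian group
acting continuously and freely on `X_{k+1}`, whose orbits are the fibres of `X_{k+1} → X_k`, and
such that the cubes on `X_{k+1}` lying above a given cube of `X_k` are the translates of any one of
them by the cubes of `𝒟_{k+1}(A)`. The group and its action are unique up to isomorphism. -/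
structure IsStructureGroup (X : Type u) [TopologicalSpace X] [Cubespace X] (k : ℕ)
    (A : Type u) [AddCommGroup A] [TopologicalSpace A] [AddAction A (CharFactor X (k + 1))] :
    Prop where
  topologicalGroup : IsTopologicalAddGroup A
  compact : CompactSpace A
  hausdorff : T2Space A
  secondCountable : SecondCountableTopology A
  continuous_action : ContinuousVAdd A (CharFactor X (k + 1))
  free : ∀ (a : A) (x : CharFactor X (k + 1)), a +ᵥ x = x → a = 0
  orbits : ∀ x y : X, charProj X k x = charProj X k y ↔
    ∃ a : A, a +ᵥ charProj X (k + 1) x = charProj X (k + 1) y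
  translate_cube : ∀ (n : ℕ), ∀ q ∈ cubes (X := CharFactor X (k + 1)) n, ∀ g : DCube n → A,
    (fun v => g v +ᵥ q v) ∈ cubes (X := CharFactor X (k + 1)) n ↔
      g ∈ cubes (X := DegSpace (k + 1) A) n

/-! ## Infinite-dimensional cubes, their Haar measure, and the measures `ζ` -/

/-- `Cu^ω(X)`: the maps on the infinite cube restricting to an `n`-cube on each
`{0,1}ⁿ × {0}`. -/
def omegaCubes (X : Type u) [Cubespace X] : Set (F2w → X) :=
  {q | ∀ n, q ∘ embedCube n ∈ cubes n}

/-- `μ`, a measure on `X^{𝔽₂^ω}`, is the Haar probability measure of `Cu^ω(X)`: it is concentrated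
on `Cu^ω(X)`, and for each `k ≥ 0` its image on `Cu^ω(X_{k+1})` is invariant under the structure
group `Cu^ω(𝒟_{k+1}(Z_{k+1}))` of the bundle `Cu^ω(X_{k+1}) → Cu^ω(X_k)`. In other words, the image
of `μ` on each iterated compact abelian bundle `Cu^ω(X_k)` is the Haar measure of that bundle. For
compact profinite-step nilspaces there is exactly one such measure. -/
structure IsOmegaHaar (X : Type u) [TopologicalSpace X] [MeasurableSpace X] [Cubespace X]
    (μ : Measure (F2w → X)) : Prop where
  isProbabilityMeasure : IsProbabilityMeasure μ
  concentrated : μ (omegaCubes X)ᶜ = 0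
  invariant : ∀ k : ℕ, ∃ (A : Type u) (_ : AddCommGroup A) (_ : TopologicalSpace A)
    (_ : AddAction A (CharFactor X (k + 1))), IsStructureGroup X k A ∧
      ∀ g ∈ omegaCubes (DegSpace (k + 1) A),
        (μ.map (fun q v => charProj X (k + 1) (q v))).map
            (fun c v => (show A from g v) +ᵥ c v) =
          μ.map (fun q v => charProj X (k + 1) (q v))

open Classical in
/-- The Haar measure of `Cu^ω(X)`, as a measure on `X^{𝔽₂^ω}`. -/
noncomputable def omegaHaar (X : Type u) [TopologicalSpace X] [MeasurableSpace X] [Cubespace X] :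
    Measure (F2w → X) :=
  if h : ∃ μ, IsOmegaHaar X μ then h.choose else 0

/-- `ζ_{X,m} = ∫_{Cu^ω(X)} ∏_v m(q(v)) dμ_{Cu^ω(X)}(q)`. -/
noncomputable def zeta {X : Type u} [TopologicalSpace X] [MeasurableSpace X] [Cubespace X]
    {B : Type v} [MeasurableSpace B] (m : X → ProbabilityMeasure B) : Measure (F2w → B) :=
  (omegaHaar X).bind fun q => Measure.infinitePi fun v => (m (q v) : Measure B)

/-! ## Affine exchangeability and the independence property -/

/-- Invariance under the coordinate permutations induced by all invertible affine maps of
`𝔽₂^ω`. -/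
def IsAffineExchangeable {B : Type v} [MeasurableSpace B] (μ : Measure (F2w → B)) : Prop :=
  ∀ T : F2w ≃ᵃ[ZMod 2] F2w, μ.map (fun b v => b (T v)) = μ

/-- The finite face with set `S` of free coordinates through the point `z`. -/
def finiteFace (S : Finset ℕ) (z : F2w) : Set F2w := {v | ∀ i ∉ S, v i = z i}

/-- The independence property: the σ-algebras of two finite faces that are disjoint and have
disjoint sets of free coordinates are independent. -/
def HasIndependenceProperty {B : Type v} [MeasurableSpace B] (μ : Measure (F2w → B)) : Prop :=
  ∀ (S₁ S₂ : Finset ℕ) (z₁ z₂ : F2w), Disjoint S₁ S₂ →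
    Disjoint (finiteFace S₁ z₁) (finiteFace S₂ z₂) →
    IndepFun (Set.domRestrict (π := fun _ => B) (finiteFace S₁ z₁))
      (Set.domRestrict (π := fun _ => B) (finiteFace S₂ z₂)) μ

/-- `X` represents the affine-exchangeable measures on `B^{𝔽₂^ω}`. -/
def Represents (X : Type u) [TopologicalSpace X] [MeasurableSpace X] [Cubespace X]
    (B : Type v) [MeasurableSpace B] : Prop :=
  ∀ μ : Measure (F2w → B), IsProbabilityMeasure μ → IsAffineExchangeable μ →
    HasIndependenceProperty μ →
      ∃ m : X → ProbabilityMeasure B, Measurable m ∧ μ = zeta m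

/-! ## Convergent sequences of functions and limit domains -/

/-- The least `k` with `L ⊆ 𝔽₂ᵏ × {0}`. -/
def ambientDim (L : Finset F2w) : ℕ := L.sup fun v => v.support.sup Nat.succ

/-- `μ_{L,f}`: the law of `(f (A v))_{v ∈ L}` for a uniformly random affine map
`A v = a₀ + ∑ i, v i • a i` from `𝔽₂ᵏ` to `𝔽₂ⁿ`, where `L ⊆ 𝔽₂ᵏ × {0}`. (Any `k` with this
property gives the same law; the least one is taken.) -/
noncomputable def sampleMeasure {B : Type v} [MeasurableSpace B] {n : ℕ} (L : Finset F2w)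
    (f : DCube n → B) : Measure (L → B) :=
  ((PMF.uniformOfFintype (DCube n × (Fin (ambientDim L) → DCube n))).map
    fun a (v : L) => f (a.1 + ∑ i : Fin (ambientDim L), (v : F2w) i • a.2 i)).toMeasure

/-- Vague convergence of measures on a compact space. -/
def VagueTendsto {Y : Type w} [TopologicalSpace Y] [MeasurableSpace Y] (μ : ℕ → Measure Y)
    (ν : Measure Y) : Prop :=
  ∀ t : C(Y, ℝ), Tendsto (fun n => ∫ y, t y ∂(μ n)) atTop (𝓝 (∫ y, t y ∂ν))

/-- Convergence of a sequence of functions `fₙ : 𝔽₂ⁿ → B`. -/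
def IsConvergentSeq {B : Type v} [TopologicalSpace B] [MeasurableSpace B]
    (f : ∀ n : ℕ, DCube n → B) : Prop :=
  ∀ L : Finset F2w, ∃ ν : Measure (L → B), IsProbabilityMeasure ν ∧
    VagueTendsto (fun n => sampleMeasure L (f n)) ν

/-- `X` is a limit domain for convergent sequences of functions `fₙ : 𝔽₂ⁿ → B`. -/
def IsLimitDomain (X : Type u) [TopologicalSpace X] [MeasurableSpace X] [Cubespace X]
    (B : Type v) [TopologicalSpace B] [MeasurableSpace B] : Prop :=
  ∀ f : ∀ n : ℕ, DCube n → B, IsConvergentSeq f →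
    ∃ m : X → ProbabilityMeasure B, Measurable m ∧ ∀ L : Finset F2w,
      VagueTendsto (fun n => sampleMeasure L (f n))
        ((zeta m).map fun b (v : L) => b v)

open scoped BigOperators

/-! ## Averages over finite groups -/

/-! The affine-exchangeable probability measures on `F2w → B` with the independence property are
exactly the limits of convergent sequences `f n : DCube n → B`. Hence both sides of the equivalence
say that each such measure has the form `zeta m`.

Every convergent sequence has such a limit (`exists_limit_measure`). Compose `f n` with a random
affine map and take a cluster point of the laws. Precomposing with an invertible affine map permutes
the affine maps, and affine maps can be prescribed independently on two disjoint faces with no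
common free coordinate; so both properties already hold at finite level, up to truncating to
finitely many coordinates.

Conversely, such a `μ` is the limit of the restrictions to the finite cubes of almost every point
`b` of `F2w → B` (`exists_sequence_tendsto`). The second moment of a centred observable, averaged
over affine copies in the `n`-cube, is a sum over pairs of copies. A generic pair can be moved onto
two independent faces and contributes zero; degenerate pairs have probability `O(2⁻ⁿ)`. This is
summable, so almost sure convergence follows, simultaneously for a countable dense family of
observables. -/

/-- The pushforward of the uniform distribution under a homomorphism of finite groups depends only
on the range of the homomorphism. -/
theorem expect_comp_eq_of_range {G₁ G₂ H : Type*} [AddCommGroup G₁] [AddCommGroup G₂]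
    [AddCommGroup H] [Fintype G₁] [Fintype G₂] (φ₁ : G₁ →+ H) (φ₂ : G₂ →+ H)
    (h₁ : ∀ x, ∃ y, φ₂ y = φ₁ x) (h₂ : ∀ y, ∃ x, φ₁ x = φ₂ y) (F : H → ℝ) :
    𝔼 x, F (φ₁ x) = 𝔼 y, F (φ₂ y) := by
  -- For fixed `y`, `φ₂ y` is a value of `φ₁`, so a translation of `x` absorbs it. The resulting
  -- double average is symmetric in the two maps.
  calc 𝔼 x, F (φ₁ x) = 𝔼 y, 𝔼 x, F (φ₁ x + φ₂ y) := by
        rw [← Fintype.expect_const (ι := G₂) (𝔼 x, F (φ₁ x))]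
        refine Finset.expect_congr rfl fun y _ => ?_
        obtain ⟨t, ht⟩ := h₂ y
        exact Fintype.expect_equiv (Equiv.addRight (-t)) _ _ fun x => by simp [← ht]
    _ = 𝔼 x, 𝔼 y, F (φ₁ x + φ₂ y) := Finset.expect_comm _ _ _
    _ = 𝔼 y, F (φ₂ y) := by
        rw [← Fintype.expect_const (ι := G₁) (𝔼 y, F (φ₂ y))]
        refine Finset.expect_congr rfl fun x _ => ?_
        obtain ⟨t, ht⟩ := h₁ x
        exact Fintype.expect_equiv (Equiv.addLeft t) _ _ fun y => by simp [← ht]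

/-- Two homomorphisms on a finite group whose values can be prescribed independently are
independent random variables. -/
theorem expect_mul_comp {G H₁ H₂ : Type*} [AddCommGroup G] [AddCommGroup H₁] [AddCommGroup H₂]
    [Fintype G] (φ₁ : G →+ H₁) (φ₂ : G →+ H₂) (h : ∀ x, ∃ y, φ₁ y = 0 ∧ φ₂ y = φ₂ x)
    (F₁ : H₁ → ℝ) (F₂ : H₂ → ℝ) :
    𝔼 x, F₁ (φ₁ x) * F₂ (φ₂ x) = (𝔼 x, F₁ (φ₁ x)) * 𝔼 x, F₂ (φ₂ x) := by
  -- Translating `x` by an element of `ker φ₁` changes `φ₂ x` by any prescribed value of `φ₂`;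
  -- averaging over that value decouples the factors.
  calc 𝔼 x, F₁ (φ₁ x) * F₂ (φ₂ x) = 𝔼 y, 𝔼 x, F₁ (φ₁ x) * F₂ (φ₂ x + φ₂ y) := by
        rw [← Fintype.expect_const (ι := G) (𝔼 x, F₁ (φ₁ x) * F₂ (φ₂ x))]
        refine Finset.expect_congr rfl fun y _ => ?_
        obtain ⟨t, ht, ht'⟩ := h y
        exact Fintype.expect_equiv (Equiv.addRight (-t)) _ _ fun x => by simp [ht, ← ht']
    _ = 𝔼 x, 𝔼 y, F₁ (φ₁ x) * F₂ (φ₂ x + φ₂ y) := Finset.expect_comm _ _ _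
    _ = 𝔼 x, F₁ (φ₁ x) * 𝔼 y, F₂ (φ₂ y) := by
        refine Finset.expect_congr rfl fun x _ => ?_
        rw [← Finset.mul_expect]
        congr 1
        exact Fintype.expect_equiv (Equiv.addLeft x) _ _ fun y => by simp
    _ = _ := by rw [Finset.expect_mul]

/-! ## Affine maps on the infinite cube -/

section AffEval

variable {V : Type*} [AddCommGroup V] [Module (ZMod 2) V]

/-- The map `v ↦ a₀ + ∑ i < k, v i • a i` on the infinite cube, as a homomorphism in `a`. -/
def affEval (k : ℕ) : V × (Fin k → V) →+ (F2w → V) where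
  toFun a v := a.1 + ∑ i : Fin k, v i • a.2 i
  map_zero' := by ext; simp
  map_add' a b := by
    ext v
    simp only [Prod.fst_add, Prod.snd_add, Pi.add_apply, smul_add, Finset.sum_add_distrib]
    abel

theorem affEval_apply (k : ℕ) (a : V × (Fin k → V)) (v : F2w) :
    affEval k a v = a.1 + ∑ i : Fin k, v i • a.2 i := rfl

/-- `affEval k a` as an affine map. -/
noncomputable def affEvalMap (k : ℕ) (a : V × (Fin k → V)) : F2w →ᵃ[ZMod 2] V where
  toFun := affEval k a
  linear := ∑ i : Fin k, (Finsupp.lapply (i : ℕ)).smulRight (a.2 i)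
  map_vadd' p v := by
    simp only [affEval_apply, vadd_eq_add, Finsupp.add_apply, add_smul, Finset.sum_add_distrib,
      LinearMap.sum_apply, LinearMap.smulRight_apply, Finsupp.lapply_apply]
    abel

/-- On points supported in the first `k` coordinates only the values at `0` and at the first `k`
basis vectors matter. Claims on ranges of `affEval` thus become claims on the existence of affine
maps. -/
theorem exists_affEval_eq (k : ℕ) (A : F2w →ᵃ[ZMod 2] V) :
    ∃ a : V × (Fin k → V), ∀ v : F2w, v.support ⊆ Finset.range k → affEval k a v = A v := by
  refine ⟨(A 0, fun i => A.linear (Finsupp.single (i : ℕ) 1)), fun v hv => ?_⟩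
  have h1 : A v = A.linear v + A 0 := by simpa using A.map_vadd 0 v
  have h2 : A.linear v = ∑ i ∈ Finset.range k, v i • A.linear (Finsupp.single i 1) := by
    conv_lhs => rw [← Finsupp.sum_single v]
    rw [Finsupp.sum_of_support_subset v hv _ (by simp), map_sum]
    refine Finset.sum_congr rfl fun i _ => ?_
    rw [← map_smul, Finsupp.smul_single, smul_eq_mul, mul_one]
  rw [h1, h2, affEval_apply, add_comm, Finset.sum_range]

/-- Composition with `T` and with its inverse shows that the two evaluation homomorphisms have the
same range. With `T` the identity, this says that the choice of `k` is immaterial. -/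
theorem expect_affEval_comp [Fintype V] {ι : Type*} {k k' : ℕ} (T : F2w ≃ᵃ[ZMod 2] F2w)
    (x : ι → F2w) (hx : ∀ i, (x i).support ⊆ Finset.range k)
    (hTx : ∀ i, (T (x i)).support ⊆ Finset.range k') (F : (ι → V) → ℝ) :
    𝔼 a : V × (Fin k' → V), F (fun i => affEval k' a (T (x i))) =
      𝔼 a : V × (Fin k → V), F (fun i => affEval k a (x i)) := by
  refine expect_comp_eq_of_range
    ((AddMonoidHom.pi fun i => Pi.evalAddMonoidHom (fun _ => V) (T (x i))).comp (affEval k'))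
    ((AddMonoidHom.pi fun i => Pi.evalAddMonoidHom (fun _ => V) (x i)).comp (affEval k))
    (fun a => ?_) (fun a => ?_) F
  · obtain ⟨b, hb⟩ := exists_affEval_eq k ((affEvalMap k' a).comp T.toAffineMap)
    exact ⟨b, funext fun i => hb _ (hx i)⟩
  · obtain ⟨b, hb⟩ := exists_affEval_eq k' ((affEvalMap k a).comp T.symm.toAffineMap)
    refine ⟨b, funext fun i => (hb _ (hTx i)).trans ?_⟩
    change affEval k a (T.symm (T (x i))) = affEval k a (x i)
    rw [T.symm_apply_apply]

/-- The affine projection onto the finite face with free coordinates `S` through `z`. -/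
noncomputable def faceProj (S : Finset ℕ) (z : F2w) : F2w →ᵃ[ZMod 2] F2w where
  toFun w := w.filter (· ∈ S) + z.filter (· ∉ S)
  linear :=
    { toFun := fun w => w.filter (· ∈ S)
      map_add' := fun _ _ => Finsupp.filter_add
      map_smul' := fun _ _ => Finsupp.filter_smul }
  map_vadd' p v := by
    simp only [vadd_eq_add, Finsupp.filter_add, LinearMap.coe_mk, AddHom.coe_mk]
    abel

theorem faceProj_apply (S : Finset ℕ) (z w : F2w) (i : ℕ) :
    faceProj S z w i = if i ∈ S then w i else z i := by
  change (w.filter (· ∈ S) + z.filter (· ∉ S)) i = _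
  by_cases hi : i ∈ S <;> simp [hi]

theorem faceProj_eq_self {S : Finset ℕ} {z w : F2w} (hw : w ∈ finiteFace S z) :
    faceProj S z w = w := by
  ext i
  rw [faceProj_apply]
  split_ifs with hi
  · rfl
  · exact (hw i hi).symm

theorem faceProj_eq_of_disjoint {S S' : Finset ℕ} {z z' w : F2w} (h : Disjoint S S')
    (hw : w ∈ finiteFace S' z') : faceProj S z w = faceProj S z z' := by
  ext i
  rw [faceProj_apply, faceProj_apply]
  split_ifs with hi
  · exact hw i (Finset.disjoint_left.1 h hi)
  · rfl

/-- Otherwise the point equal to `z₂` on `S₁` and to `z₁` elsewhere would lie in both faces. -/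
theorem exists_coord_of_disjoint_finiteFace {S₁ S₂ : Finset ℕ} {z₁ z₂ : F2w}
    (hF : Disjoint (finiteFace S₁ z₁) (finiteFace S₂ z₂)) :
    ∃ j, j ∉ S₁ ∧ j ∉ S₂ ∧ z₁ j ≠ z₂ j := by
  by_contra! hj
  refine Set.disjoint_left.1 hF
    (show faceProj S₁ z₁ z₂ ∈ finiteFace S₁ z₁ from fun i hi => ?_) fun i hi => ?_
  · rw [faceProj_apply, if_neg hi]
  · rw [faceProj_apply]
    split_ifs with h1
    · rfl
    · exact hj i h1 hi

/-- Affine maps can be prescribed independently on two finite faces that are disjoint and have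
disjoint sets of free coordinates. -/
theorem exists_affineMap_eqOn_faces {S₁ S₂ : Finset ℕ} {z₁ z₂ : F2w} (hS : Disjoint S₁ S₂)
    (hF : Disjoint (finiteFace S₁ z₁) (finiteFace S₂ z₂)) (A₁ A₂ : F2w →ᵃ[ZMod 2] V) :
    ∃ A : F2w →ᵃ[ZMod 2] V, (∀ w ∈ finiteFace S₁ z₁, A w = A₁ w) ∧
      ∀ w ∈ finiteFace S₂ z₂, A w = A₂ w := by
  obtain ⟨j, hj1, hj2, hj⟩ := exists_coord_of_disjoint_finiteFace hF
  have hone : z₂ j - z₁ j = 1 := by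
    generalize z₁ j = a at hj ⊢
    generalize z₂ j = b at hj ⊢
    decide +revert
  -- Each map composed with its own face projection is constant on the other face: `A₂` contributes
  -- `p` on the first and `A₁` contributes `q` on the second. As coordinate `j` separates the faces,
  -- an affine function of it removes both constants.
  set p := A₂ (faceProj S₂ z₂ z₁)
  set q := A₁ (faceProj S₁ z₁ z₂)
  let l : F2w →ᵃ[ZMod 2] V := ((Finsupp.lapply j).smulRight (p - q)).toAffineMap
  refine ⟨A₁.comp (faceProj S₁ z₁) + A₂.comp (faceProj S₂ z₂) + l
    - AffineMap.const (ZMod 2) F2w (z₁ j • (p - q) + p), fun w hw => ?_, fun w hw => ?_⟩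
  · have hl : l w = z₁ j • (p - q) := by rw [← hw j hj1]; rfl
    simp only [AffineMap.coe_sub, AffineMap.coe_add, Pi.sub_apply, Pi.add_apply,
      AffineMap.comp_apply, AffineMap.const_apply, faceProj_eq_self hw,
      faceProj_eq_of_disjoint hS.symm hw, hl]
    abel
  · have hl : l w = z₁ j • (p - q) + (p - q) := by
      rw [show l w = w j • (p - q) from rfl, hw j hj2, sub_eq_iff_eq_add'.1 hone, add_smul,
        one_smul]
    simp only [AffineMap.coe_sub, AffineMap.coe_add, Pi.sub_apply, Pi.add_apply,
      AffineMap.comp_apply, AffineMap.const_apply, faceProj_eq_self hw,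
      faceProj_eq_of_disjoint hS hw, hl]
    abel

/-- The values of a random affine map on two finite faces that are disjoint and have disjoint sets
of free coordinates are independent. -/
theorem expect_affEval_mul [Fintype V] {ι₁ ι₂ : Type*} {k : ℕ} {S₁ S₂ : Finset ℕ} {z₁ z₂ : F2w}
    (hS : Disjoint S₁ S₂) (hF : Disjoint (finiteFace S₁ z₁) (finiteFace S₂ z₂))
    (x₁ : ι₁ → F2w) (x₂ : ι₂ → F2w) (h₁ : ∀ i, x₁ i ∈ finiteFace S₁ z₁)
    (h₂ : ∀ i, x₂ i ∈ finiteFace S₂ z₂) (hx₁ : ∀ i, (x₁ i).support ⊆ Finset.range k)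
    (hx₂ : ∀ i, (x₂ i).support ⊆ Finset.range k) (F₁ : (ι₁ → V) → ℝ) (F₂ : (ι₂ → V) → ℝ) :
    𝔼 a : V × (Fin k → V), F₁ (fun i => affEval k a (x₁ i)) * F₂ (fun i => affEval k a (x₂ i)) =
      (𝔼 a : V × (Fin k → V), F₁ (fun i => affEval k a (x₁ i))) *
        𝔼 a : V × (Fin k → V), F₂ (fun i => affEval k a (x₂ i)) := by
  refine expect_mul_comp
    ((AddMonoidHom.pi fun i => Pi.evalAddMonoidHom (fun _ => V) (x₁ i)).comp (affEval k))
    ((AddMonoidHom.pi fun i => Pi.evalAddMonoidHom (fun _ => V) (x₂ i)).comp (affEval k))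
    (fun a => ?_) F₁ F₂
  -- Taking the zero map on the first face gives the kernel element that `expect_mul_comp` requires.
  obtain ⟨A, hA1, hA2⟩ := exists_affineMap_eqOn_faces hS hF 0 (affEvalMap k a)
  obtain ⟨b, hb⟩ := exists_affEval_eq k A
  exact ⟨b, funext fun i => (hb _ (hx₁ i)).trans (hA1 _ (h₁ i)),
    funext fun i => (hb _ (hx₂ i)).trans (hA2 _ (h₂ i))⟩

/-- A random family of `k` vectors in a finite space `V` is linearly dependent with probability at
most `2ᵏ / |V|`. -/
theorem expect_not_linearIndependent_le [Fintype V] (k : ℕ) :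
    (𝔼 a : V × (Fin k → V),
      Set.indicator {a | ¬ LinearIndependent (ZMod 2) a.2} (fun _ => (1 : ℝ)) a) ≤
      2 ^ k / Fintype.card V := by
  classical
  -- A nontrivial combination of uniform vectors is uniform on `V`. A union bound over the
  -- coefficients `g` follows; counting `g = 0` as well gives the constant `2 ^ k`.
  have key : ∀ g : Fin k → ZMod 2, g ≠ 0 →
      (𝔼 a : V × (Fin k → V), if ∑ i, g i • a.2 i = (0 : V) then (1 : ℝ) else 0) =
        1 / Fintype.card V := by
    intro g hg
    obtain ⟨i, hi⟩ := Function.ne_iff.1 hg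
    have hi1 : g i = 1 := by
      generalize g i = c at hi
      revert hi
      simp only [Pi.zero_apply]
      decide +revert
    let φ : V × (Fin k → V) →+ V :=
      { toFun := fun a => ∑ i, g i • a.2 i
        map_zero' := by simp
        map_add' := fun a b => by simp [Finset.sum_add_distrib] }
    have := expect_comp_eq_of_range φ (AddMonoidHom.id V) (fun x => ⟨_, rfl⟩)
      (fun y => ⟨(0, Pi.single i y), by
        change ∑ j, g j • (Pi.single i y : Fin k → V) j = y
        rw [Finset.sum_eq_single i (fun j _ hj => by simp [hj]) (by simp)]
        simp [hi1]⟩) (fun v => if v = 0 then (1 : ℝ) else 0)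
    refine this.trans ?_
    simp
  calc _ ≤ 𝔼 a : V × (Fin k → V), ∑ g ∈ Finset.univ.erase (0 : Fin k → ZMod 2),
        if ∑ i, g i • a.2 i = (0 : V) then (1 : ℝ) else 0 := by
        refine Finset.expect_le_expect fun a _ => ?_
        rw [Set.indicator_apply]
        split_ifs with ha
        · rw [Set.mem_ofPred_eq, Fintype.linearIndependent_iff] at ha
          push Not at ha
          obtain ⟨g, hg, i, hi⟩ := ha
          have hg0 : g ∈ Finset.univ.erase (0 : Fin k → ZMod 2) :=
            Finset.mem_erase.2 ⟨fun h => hi (by simp [h]), Finset.mem_univ _⟩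
          refine le_trans (by rw [if_pos hg]) (Finset.single_le_sum
            (f := fun g : Fin k → ZMod 2 => if ∑ i, g i • a.2 i = (0 : V) then (1 : ℝ) else 0)
            (fun g _ => ?_) hg0)
          positivity
        · positivity
    _ = ∑ g ∈ Finset.univ.erase (0 : Fin k → ZMod 2), 1 / (Fintype.card V : ℝ) := by
        rw [Finset.expect_sum_comm]
        exact Finset.sum_congr rfl fun g hg => key g (Finset.mem_erase.1 hg).1
    _ ≤ ∑ g : Fin k → ZMod 2, 1 / (Fintype.card V : ℝ) :=
        Finset.sum_le_sum_of_subset_of_nonneg (Finset.erase_subset _ _) fun _ _ _ => by positivity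
    _ = 2 ^ k / Fintype.card V := by
        simp [ZMod.card, div_eq_mul_inv]

end AffEval

/-! ## Extending affine embeddings of finite cubes -/

theorem embedCube_apply (n : ℕ) (v : DCube n) (j : ℕ) :
    embedCube n v j = if h : j < n then v ⟨j, h⟩ else 0 := by
  split_ifs with h
  · exact Finsupp.embDomain_apply_self Fin.valEmbedding _ (⟨j, h⟩ : Fin n)
  · refine Finsupp.embDomain_of_notMem_range _ _ _ ?_
    rintro ⟨i, rfl⟩
    exact h i.2

/-- `embedCube n` as a linear map. -/
noncomputable def embedCubeLin (n : ℕ) : DCube n →ₗ[ZMod 2] F2w where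
  toFun := embedCube n
  map_add' v w := by
    ext j
    rw [Finsupp.add_apply, embedCube_apply, embedCube_apply, embedCube_apply]
    split_ifs <;> simp
  map_smul' c v := by
    ext j
    rw [Finsupp.smul_apply, embedCube_apply, embedCube_apply]
    split_ifs <;> simp

theorem embedCubeLin_apply (n : ℕ) (v : DCube n) : embedCubeLin n v = embedCube n v := rfl

theorem embedCubeLin_injective (n : ℕ) : Function.Injective (embedCubeLin n) := fun v w h =>
  funext fun i => by
    have := DFunLike.congr_fun h (i : ℕ)
    simpa [embedCubeLin_apply, embedCube_apply] using this

theorem embedCube_restrict {k : ℕ} {v : F2w} (hv : v.support ⊆ Finset.range k) :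
    embedCube k (fun i => v i) = v := by
  ext j
  rw [embedCube_apply]
  split_ifs with h
  · rfl
  · by_contra hj
    exact h (Finset.mem_range.1 (hv (Finsupp.mem_support_iff.2 (Ne.symm hj))))

/-- An injective affine map from a finite cube to a finite cube extends to an invertible affine map
of the infinite cube. -/
theorem exists_affineEquiv_extends {n k : ℕ} (a : DCube n × (Fin k → DCube n))
    (ha : LinearIndependent (ZMod 2) a.2) :
    ∃ T : F2w ≃ᵃ[ZMod 2] F2w, ∀ v : F2w, v.support ⊆ Finset.range k →
      T v = embedCube n (affEval k a v) := by
  let ψ : DCube k →ₗ[ZMod 2] F2w := (embedCubeLin n).comp (Fintype.linearCombination (ZMod 2) a.2)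
  have hψ : Function.Injective ψ :=
    (embedCubeLin_injective n).comp (ha.fintypeLinearCombination_injective)
  -- An isomorphism between finite-dimensional subspaces of `F2w` extends to an automorphism.
  obtain ⟨g, hg⟩ := Submodule.exists_linearEquiv_restrict_eq
    ((LinearEquiv.ofInjective _ (embedCubeLin_injective k)).symm.trans
      (LinearEquiv.ofInjective ψ hψ))
  refine ⟨g.toAffineEquiv.trans (AffineEquiv.constVAdd (ZMod 2) F2w (embedCube n a.1)),
    fun v hv => ?_⟩
  have h := hg (LinearEquiv.ofInjective _ (embedCubeLin_injective k) (fun i => v i))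
  rw [LinearEquiv.trans_apply, LinearEquiv.symm_apply_apply, LinearEquiv.ofInjective_apply,
    LinearEquiv.ofInjective_apply, embedCubeLin_apply, embedCube_restrict hv] at h
  change embedCubeLin n a.1 + g v = embedCubeLin n (affEval k a v)
  rw [← h, affEval_apply, map_add]
  rfl

/-! ## Sampling measures as averages -/

theorem integral_uniformOfFintype_map {G Y : Type*} [Fintype G] [Nonempty G] [MeasurableSpace Y]
    (g : G → Y) {t : Y → ℝ} (ht : Measurable t) :
    ∫ y, t y ∂((PMF.uniformOfFintype G).map g).toMeasure = 𝔼 x, t (g x) := by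
  let _ : MeasurableSpace G := ⊤
  have hg : Measurable g := measurable_from_top
  rw [← PMF.toMeasure_map g _ hg, integral_map hg.aemeasurable ht.aestronglyMeasurable,
    PMF.integral_eq_sum, Fintype.expect_eq_sum_div_card, Finset.sum_div]
  refine Finset.sum_congr rfl fun x _ => ?_
  simp [div_eq_inv_mul]

theorem support_subset_range_ambientDim {L : Finset F2w} {v : F2w} (hv : v ∈ L) :
    v.support ⊆ Finset.range (ambientDim L) := fun i hi => Finset.mem_range.2 <|
  (Nat.lt_succ_self i).trans_le <| (Finset.le_sup (f := Nat.succ) hi).trans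
    (Finset.le_sup (f := fun v : F2w => v.support.sup Nat.succ) hv)

theorem exists_support_subset_range {ι : Type*} [Finite ι] (x : ι → F2w) :
    ∃ k, ∀ i, (x i).support ⊆ Finset.range k := by
  classical
  have := Fintype.ofFinite ι
  exact ⟨ambientDim (Finset.univ.image x), fun i =>
    support_subset_range_ambientDim (Finset.mem_image_of_mem x (Finset.mem_univ i))⟩

section Law

variable {B : Type*} [MetricSpace B] [CompactSpace B] [MeasurableSpace B] [BorelSpace B]

/-- The freedom in `k` allows `k = n` later, so that one random map serves all `L` at once. -/
theorem integral_sampleMeasure {n k : ℕ} {L : Finset F2w}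
    (hk : ∀ v ∈ L, v.support ⊆ Finset.range k) (f : DCube n → B) (t : C(L → B, ℝ)) :
    ∫ y, t y ∂(sampleMeasure L f) =
      𝔼 a : DCube n × (Fin k → DCube n), t (fun v => f (affEval k a v)) := by
  rw [sampleMeasure, integral_uniformOfFintype_map _ t.continuous.measurable]
  exact expect_affEval_comp (V := DCube n) (AffineEquiv.refl (ZMod 2) F2w) (fun v : L => (v : F2w))
    (fun v => hk v v.2) (fun v => support_subset_range_ambientDim v.2) (fun y => t (fun v => f (y v)))

theorem integrable_continuousMap {Y : Type*} [TopologicalSpace Y] [CompactSpace Y]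
    [MeasurableSpace Y] [BorelSpace Y] (μ : Measure Y) [IsFiniteMeasure μ] (t : C(Y, ℝ)) :
    Integrable t μ :=
  (BoundedContinuousFunction.mkOfCompact t).integrable μ

/-- A finite measure on `B^{𝔽₂^ω}` is determined by the integrals of continuous functions of
finitely many coordinates. -/
theorem measure_ext_of_integral_cylinder {μ ν : Measure (F2w → B)} [IsFiniteMeasure μ]
    [IsFiniteMeasure ν] (h : ∀ (L : Finset F2w) (t : C(L → B, ℝ)),
      ∫ b, t (fun v => b v) ∂μ = ∫ b, t (fun v => b v) ∂ν) : μ = ν := by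
  refine IsProjectiveLimit.unique (P := fun L => μ.map L.restrict) (fun L => rfl) fun L => ?_
  refine (ext_of_forall_integral_eq_of_IsFiniteMeasure fun t => ?_).symm
  have hr := L.measurable_restrict (X := fun _ : F2w => B)
  rw [integral_map hr.aemeasurable t.continuous.measurable.aestronglyMeasurable,
    integral_map hr.aemeasurable t.continuous.measurable.aestronglyMeasurable]
  exact h L t.toContinuousMap

/-! ### Limit measures of sequences of functions -/

/-- The laws of the random maps `fₙ ∘ A` on the infinite cube, `A` a random affine map, have a
cluster point. -/
theorem exists_ultrafilter_limit (f : ∀ n : ℕ, DCube n → B) :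
    ∃ (U : Ultrafilter ℕ) (μ : Measure (F2w → B)), (U : Filter ℕ) ≤ atTop ∧
      IsProbabilityMeasure μ ∧ ∀ t : C(F2w → B, ℝ),
        Tendsto (fun n => 𝔼 a : DCube n × (Fin n → DCube n), t (fun v => f n (affEval n a v)))
          U (𝓝 (∫ b, t b ∂μ)) := by
  -- The `n`-th law sees only the first `n` coordinates of `v`, which suffices eventually for any
  -- finite set of points. Compactness of the space of probability measures gives the cluster point.
  let σ : ℕ → ProbabilityMeasure (F2w → B) := fun n =>
    ⟨((PMF.uniformOfFintype (DCube n × (Fin n → DCube n))).map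
      fun a v => f n (affEval n a v)).toMeasure, inferInstance⟩
  obtain ⟨μ, -, hμ⟩ := isCompact_univ.ultrafilter_le_nhds ((hyperfilter ℕ).map σ) (by simp)
  refine ⟨hyperfilter ℕ, μ, Nat.hyperfilter_le_atTop, inferInstance, fun t => ?_⟩
  have hσ : Tendsto σ (hyperfilter ℕ) (𝓝 μ) := hμ
  have := ProbabilityMeasure.tendsto_iff_forall_integral_tendsto.1 hσ
    (BoundedContinuousFunction.mkOfCompact t)
  refine this.congr fun n => ?_
  exact integral_uniformOfFintype_map _ t.continuous.measurable

theorem finite_finiteFace (S : Finset ℕ) (z : F2w) : Finite (finiteFace S z) := by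
  refine Finite.of_injective (fun (w : finiteFace S z) (i : S) => (w : F2w) i) fun w w' h => ?_
  refine Subtype.ext (Finsupp.ext fun i => ?_)
  by_cases hi : i ∈ S
  · exact congrFun h ⟨i, hi⟩
  · rw [w.2 i hi, w'.2 i hi]

/-- The evaluation of `t` at finitely many coordinates. -/
def cylinderMap {ι : Type*} (x : ι → F2w) (t : C(ι → B, ℝ)) : C(F2w → B, ℝ) :=
  ⟨fun b => t (fun i => b (x i)), by fun_prop⟩

/-- On finitely many points the invariance is an exact identity once `n` bounds their supports and
those of their images, so it passes to the limit. -/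
theorem isAffineExchangeable_of_limit {f : ∀ n : ℕ, DCube n → B} {U : Ultrafilter ℕ}
    (hU : (U : Filter ℕ) ≤ atTop) {μ : Measure (F2w → B)} [IsProbabilityMeasure μ]
    (h : ∀ t : C(F2w → B, ℝ),
      Tendsto (fun n => 𝔼 a : DCube n × (Fin n → DCube n), t (fun v => f n (affEval n a v)))
        U (𝓝 (∫ b, t b ∂μ))) : IsAffineExchangeable μ := by
  intro T
  have hT : Measurable fun (b : F2w → B) v => b (T v) := by fun_prop
  have := Measure.isProbabilityMeasure_map (μ := μ) hT.aemeasurable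
  refine measure_ext_of_integral_cylinder fun L t => ?_
  refine (integral_map hT.aemeasurable
    (cylinderMap (fun v : L => (v : F2w)) t).continuous.measurable.aestronglyMeasurable).trans ?_
  obtain ⟨k, hk⟩ := exists_support_subset_range fun v : L => (v : F2w)
  obtain ⟨k', hk'⟩ := exists_support_subset_range fun v : L => T v
  refine tendsto_nhds_unique (h (cylinderMap (fun v : L => T v) t))
    ((h (cylinderMap (fun v : L => (v : F2w)) t)).congr' ?_)
  filter_upwards [hU (eventually_ge_atTop (max k k'))] with n hn
  exact (expect_affEval_comp (V := DCube n) T (fun v : L => (v : F2w))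
    (fun v => (hk v).trans (Finset.range_mono ((le_max_left _ _).trans hn)))
    (fun v => (hk' v).trans (Finset.range_mono ((le_max_right _ _).trans hn)))
    (fun y => t (fun v => f n (y v)))).symm

-- Finite faces have finitely many points, so independence can be tested on products of continuous
-- functions, whose averages factor exactly for large `n`.
omit [CompactSpace B] in
theorem hasIndependenceProperty_of_limit {f : ∀ n : ℕ, DCube n → B} {U : Ultrafilter ℕ}
    (hU : (U : Filter ℕ) ≤ atTop) {μ : Measure (F2w → B)} [IsProbabilityMeasure μ]
    (h : ∀ t : C(F2w → B, ℝ),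
      Tendsto (fun n => 𝔼 a : DCube n × (Fin n → DCube n), t (fun v => f n (affEval n a v)))
        U (𝓝 (∫ b, t b ∂μ))) : HasIndependenceProperty μ := by
  intro S₁ S₂ z₁ z₂ hS hF
  have := finite_finiteFace S₁ z₁
  have := finite_finiteFace S₂ z₂
  refine pi_indepFun_pi_of_bcf (X := fun (v : finiteFace S₁ z₁) (b : F2w → B) => b v)
    (Y := fun (v : finiteFace S₂ z₂) (b : F2w → B) => b v)
    (fun v => (measurable_pi_apply _).aemeasurable)
    (fun v => (measurable_pi_apply _).aemeasurable) fun g₁ g₂ => ?_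
  let G₁ := cylinderMap (fun v : finiteFace S₁ z₁ => (v : F2w)) g₁.toContinuousMap
  let G₂ := cylinderMap (fun v : finiteFace S₂ z₂ => (v : F2w)) g₂.toContinuousMap
  obtain ⟨k, hk⟩ := exists_support_subset_range fun v : finiteFace S₁ z₁ => (v : F2w)
  obtain ⟨k', hk'⟩ := exists_support_subset_range fun v : finiteFace S₂ z₂ => (v : F2w)
  refine tendsto_nhds_unique (h (G₁ * G₂)) (((h G₁).mul (h G₂)).congr' ?_)
  filter_upwards [hU (eventually_ge_atTop (max k k'))] with n hn
  exact (expect_affEval_mul (V := DCube n) hS hF (fun v : finiteFace S₁ z₁ => (v : F2w))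
    (fun v : finiteFace S₂ z₂ => (v : F2w)) (fun v => v.2) (fun v => v.2)
    (fun v => (hk v).trans (Finset.range_mono ((le_max_left _ _).trans hn)))
    (fun v => (hk' v).trans (Finset.range_mono ((le_max_right _ _).trans hn)))
    (fun y => g₁ (fun v => f n (y v))) (fun y => g₂ (fun v => f n (y v)))).symm

/-- The limit of a convergent sequence is given by an affine-exchangeable measure with the
independence property. -/
theorem exists_limit_measure {f : ∀ n : ℕ, DCube n → B} (hf : IsConvergentSeq f) :
    ∃ μ : Measure (F2w → B), IsProbabilityMeasure μ ∧ IsAffineExchangeable μ ∧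
      HasIndependenceProperty μ ∧ ∀ L : Finset F2w,
        VagueTendsto (fun n => sampleMeasure L (f n)) (μ.map fun b (v : L) => b v) := by
  obtain ⟨U, μ, hU, hμ, h⟩ := exists_ultrafilter_limit f
  refine ⟨μ, hμ, isAffineExchangeable_of_limit hU h, hasIndependenceProperty_of_limit hU h,
    fun L t => ?_⟩
  -- Convergence identifies the limit along `U` with the limit along the whole sequence.
  obtain ⟨ν, -, hν⟩ := hf L
  have hL : Measurable fun (b : F2w → B) (v : L) => b v := by fun_prop
  rw [integral_map hL.aemeasurable t.continuous.measurable.aestronglyMeasurable]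
  convert hν t using 2
  refine tendsto_nhds_unique (h (cylinderMap (fun v : L => (v : F2w)) t))
    (((hν t).mono_left hU).congr' ?_)
  obtain ⟨k, hk⟩ := exists_support_subset_range fun v : L => (v : F2w)
  filter_upwards [hU (eventually_ge_atTop k)] with n hn
  exact integral_sampleMeasure (fun v hv => (hk ⟨v, hv⟩).trans (Finset.range_mono hn)) (f n) t

end Law

/-! ## Sampling from an affine-exchangeable measure -/

/-- The face of the first `k` free coordinates can be moved by an invertible affine map to a face
that is disjoint from it and has no common free coordinates. -/
theorem exists_affineEquiv_disjoint_face (k : ℕ) :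
    ∃ (T : F2w ≃ᵃ[ZMod 2] F2w) (S : Finset ℕ) (z : F2w), Disjoint (Finset.range k) S ∧
      Disjoint (finiteFace (Finset.range k) 0) (finiteFace S z) ∧
      ∀ v : F2w, v.support ⊆ Finset.range k → v ∈ finiteFace (Finset.range k) 0 ∧
        T v ∈ finiteFace S z ∧ (T v).support ⊆ Finset.range (2 * k + 1) := by
  -- `e` swaps the coordinate blocks `[0, k)` and `[k, 2k)`; the extra coordinate `2 * k`, set to
  -- `1`, makes the faces disjoint.
  let e : ℕ → ℕ := fun i => if i < k then i + k else if i < 2 * k then i - k else i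
  have he : Function.Involutive e := fun i => by grind
  let T : F2w ≃ᵃ[ZMod 2] F2w := (Finsupp.domLCongr he.toPerm).toAffineEquiv.trans
    (AffineEquiv.constVAdd (ZMod 2) F2w (Finsupp.single (2 * k) 1))
  have hT : ∀ v i, T v i = (Finsupp.single (2 * k) 1 : F2w) i + v (e i) := fun v i => rfl
  refine ⟨T, Finset.Ico k (2 * k), Finsupp.single (2 * k) 1, ?_, ?_, fun v hv => ?_⟩
  · rw [Finset.disjoint_left]
    intro i hi hi'
    exact absurd (Finset.mem_range.1 hi) (Finset.mem_Ico.1 hi').1.not_gt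
  · rw [Set.disjoint_left]
    intro w hw hw'
    have h1 := hw (2 * k) (by simp; lia)
    have h2 := hw' (2 * k) (by simp)
    rw [h1] at h2
    simp at h2
  · have hv0 : ∀ i, k ≤ i → v i = 0 := fun i hi => by
      by_contra h
      exact absurd (Finset.mem_range.1 (hv (Finsupp.mem_support_iff.2 h))) hi.not_gt
    refine ⟨fun i hi => hv0 i (by simpa using hi), fun i hi => ?_, fun i hi => ?_⟩
    · rw [hT, hv0 _ (by simp only [Finset.mem_Ico] at hi; grind), add_zero]
    · by_contra h
      refine Finsupp.mem_support_iff.1 hi ?_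
      rw [Finset.mem_range] at h
      rw [hT, hv0 _ (by grind), add_zero, Finsupp.single_eq_of_ne (by lia)]

/-! ### Concentration of cube averages and convergence of samples -/

section Concentration

variable {B : Type*} [MetricSpace B] [CompactSpace B] [MeasurableSpace B] [BorelSpace B]

instance isProbabilityMeasure_sampleMeasure {n : ℕ} (L : Finset F2w) (f : DCube n → B) :
    IsProbabilityMeasure (sampleMeasure L f) := by
  unfold sampleMeasure
  infer_instance

/-- The observables of two generic affine copies of a finite face are uncorrelated. -/
theorem integral_mul_eq_zero_of_linearIndependent {μ : Measure (F2w → B)}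
    [IsProbabilityMeasure μ] (hμ : IsAffineExchangeable μ) (hi : HasIndependenceProperty μ)
    {ι : Type*} {n m : ℕ} {S₁ S₂ : Finset ℕ} {z₁ z₂ : F2w}
    (hS : Disjoint S₁ S₂) (hF : Disjoint (finiteFace S₁ z₁) (finiteFace S₂ z₂))
    (x₁ x₂ : ι → F2w) (h₁ : ∀ i, x₁ i ∈ finiteFace S₁ z₁)
    (h₂ : ∀ i, x₂ i ∈ finiteFace S₂ z₂) (hx₁ : ∀ i, (x₁ i).support ⊆ Finset.range m)
    (hx₂ : ∀ i, (x₂ i).support ⊆ Finset.range m) (s : C(ι → B, ℝ))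
    (hs : ∫ b, s (fun i => b (x₁ i)) ∂μ = 0)
    (a : DCube n × (Fin m → DCube n)) (ha : LinearIndependent (ZMod 2) a.2) :
    ∫ b, s (fun i => b (embedCube n (affEval m a (x₁ i)))) *
      s (fun i => b (embedCube n (affEval m a (x₂ i)))) ∂μ = 0 := by
  -- By exchangeability `T` carries the pair of copies back to `x₁` and `x₂`, which lie on
  -- independent faces; then `hs` kills the product.
  obtain ⟨T, hT⟩ := exists_affineEquiv_extends a ha
  simp only [← hT _ (hx₁ _), ← hT _ (hx₂ _)]
  let G : C(F2w → B, ℝ) := cylinderMap x₁ s * cylinderMap x₂ s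
  have hTm : Measurable fun (b : F2w → B) v => b (T v) := by fun_prop
  have h := integral_map (μ := μ) hTm.aemeasurable G.continuous.measurable.aestronglyMeasurable
  rw [hμ T] at h
  refine h.symm.trans ?_
  have hind := (hi S₁ S₂ z₁ z₂ hS hF).comp
    (φ := fun y => s (fun i => y ⟨x₁ i, h₁ i⟩)) (ψ := fun y => s (fun i => y ⟨x₂ i, h₂ i⟩))
    (Continuous.measurable (by fun_prop)) (Continuous.measurable (by fun_prop))
  refine (hind.integral_mul_eq_mul_integral
    (cylinderMap x₁ s).continuous.measurable.aestronglyMeasurable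
    (cylinderMap x₂ s).continuous.measurable.aestronglyMeasurable).trans ?_
  exact mul_eq_zero_of_left hs _

/-- The average of `s` over the affine copies of `(x i)ᵢ` in the `n`-dimensional cube. -/
noncomputable def cubeAverage {ι : Type*} (x : ι → F2w) (k n : ℕ) (s : C(ι → B, ℝ))
    (b : F2w → B) : ℝ :=
  𝔼 a : DCube n × (Fin k → DCube n), s (fun i => b (embedCube n (affEval k a (x i))))

omit [CompactSpace B] [MeasurableSpace B] [BorelSpace B] in
theorem continuous_cubeAverage {ι : Type*} (x : ι → F2w) (k n : ℕ) (s : C(ι → B, ℝ)) :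
    Continuous (cubeAverage x k n s) := by
  unfold cubeAverage
  simp only [Fintype.expect_eq_sum_div_card]
  fun_prop

/-- The variance of the averages over the `n`-dimensional cube decays exponentially. -/
theorem integral_cubeAverage_sq_le {μ : Measure (F2w → B)} [IsProbabilityMeasure μ]
    (hμ : IsAffineExchangeable μ) (hi : HasIndependenceProperty μ) {ι : Type*} (x : ι → F2w)
    {k : ℕ} (hx : ∀ i, (x i).support ⊆ Finset.range k) (s : C(ι → B, ℝ))
    (hs : ∫ b, s (fun i => b (x i)) ∂μ = 0) (n : ℕ) :
    ∫ b, cubeAverage x k n s b ^ 2 ∂μ ≤ ‖s‖ ^ 2 * (2 ^ (2 * k + 1) / 2 ^ n) := by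
  obtain ⟨T, S, z, hS, hF, hT⟩ := exists_affineEquiv_disjoint_face k
  have hx' : ∀ i, (x i).support ⊆ Finset.range (2 * k + 1) := fun i =>
    (hx i).trans (Finset.range_mono (by lia))
  let W : DCube n × (Fin (2 * k + 1) → DCube n) → C(F2w → B, ℝ) := fun a =>
    cylinderMap (fun i => embedCube n (affEval (2 * k + 1) a (x i))) s *
      cylinderMap (fun i => embedCube n (affEval (2 * k + 1) a (T (x i)))) s
  -- A single random affine map in `2 * k + 1` variables, evaluated at `x` and at `T ∘ x`, yields
  -- two independent copies; hence the square is one average.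
  have hsq : ∀ b, cubeAverage x k n s b ^ 2 = 𝔼 a, W a b := by
    intro b
    have h1 := expect_affEval_comp (V := DCube n) (AffineEquiv.refl (ZMod 2) F2w) x hx hx'
      (fun y => s (fun i => b (embedCube n (y i))))
    have h2 := expect_affEval_comp (V := DCube n) T x hx (fun i => (hT _ (hx i)).2.2)
      (fun y => s (fun i => b (embedCube n (y i))))
    have h3 := expect_affEval_mul (V := DCube n) hS hF x (fun i => T (x i))
      (fun i => (hT _ (hx i)).1) (fun i => (hT _ (hx i)).2.1) hx' (fun i => (hT _ (hx i)).2.2)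
      (fun y => s (fun i => b (embedCube n (y i)))) (fun y => s (fun i => b (embedCube n (y i))))
    rw [h2] at h3
    rw [sq]
    refine Eq.trans ?_ h3.symm
    exact congrArg (· * _) h1.symm
  have hW : ∀ a, ∫ b, W a b ∂μ ≤
      ‖s‖ ^ 2 * Set.indicator {a | ¬ LinearIndependent (ZMod 2) a.2} (fun _ => (1 : ℝ)) a := by
    intro a
    by_cases ha : LinearIndependent (ZMod 2) a.2
    · rw [Set.indicator_of_notMem (by simpa using ha), mul_zero]
      exact (integral_mul_eq_zero_of_linearIndependent hμ hi hS hF x (fun i => T (x i))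
        (fun i => (hT _ (hx i)).1) (fun i => (hT _ (hx i)).2.1) hx'
        (fun i => (hT _ (hx i)).2.2) s hs a ha).le
    · rw [Set.indicator_of_mem (by simpa using ha), mul_one]
      have hb : ∀ b, ‖W a b‖ ≤ ‖s‖ ^ 2 := fun b => by
        rw [sq]
        exact (norm_mul_le _ _).trans (mul_le_mul (s.norm_coe_le_norm _) (s.norm_coe_le_norm _)
          (norm_nonneg _) (norm_nonneg _))
      have := norm_integral_le_of_norm_le_const (μ := μ) (Eventually.of_forall hb)
      rw [probReal_univ, mul_one] at this
      exact (Real.le_norm_self _).trans this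
  calc ∫ b, cubeAverage x k n s b ^ 2 ∂μ = 𝔼 a, ∫ b, W a b ∂μ := by
        simp only [hsq, Fintype.expect_eq_sum_div_card]
        rw [integral_div, integral_finsetSum _ fun a _ => integrable_continuousMap μ (W a)]
    _ ≤ 𝔼 a : DCube n × (Fin (2 * k + 1) → DCube n), ‖s‖ ^ 2 *
          Set.indicator {a | ¬ LinearIndependent (ZMod 2) a.2} (fun _ => (1 : ℝ)) a :=
        Finset.expect_le_expect fun a _ => hW a
    _ ≤ ‖s‖ ^ 2 * (2 ^ (2 * k + 1) / 2 ^ n) := by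
        rw [← Finset.mul_expect]
        refine mul_le_mul_of_nonneg_left ?_ (by positivity)
        refine (expect_not_linearIndependent_le (V := DCube n) (2 * k + 1)).trans_eq ?_
        simp [ZMod.card]

/-- The series of squares has finite expectation, so it converges almost surely and its terms tend
to zero. -/
theorem ae_tendsto_zero_of_integral_sq_le {Ω : Type*} [MeasurableSpace Ω] {μ : Measure Ω}
    [IsProbabilityMeasure μ] {X : ℕ → Ω → ℝ} (hX : ∀ n, Measurable (X n))
    (hint : ∀ n, Integrable (fun ω => X n ω ^ 2) μ) {c : ℕ → ℝ} (hc : Summable c)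
    (h : ∀ n, ∫ ω, X n ω ^ 2 ∂μ ≤ c n) : ∀ᵐ ω ∂μ, Tendsto (fun n => X n ω) atTop (𝓝 0) := by
  have hm : ∀ n, Measurable fun ω => ENNReal.ofReal (X n ω ^ 2) := fun n =>
    ((hX n).pow_const 2).ennreal_ofReal
  have hlt : ∫⁻ ω, ∑' n, ENNReal.ofReal (X n ω ^ 2) ∂μ ≠ ⊤ := by
    rw [lintegral_tsum fun n => (hm n).aemeasurable]
    refine ne_top_of_le_ne_top hc.tsum_ofReal_ne_top (ENNReal.tsum_le_tsum fun n => ?_)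
    rw [← ofReal_integral_eq_lintegral_ofReal (hint n) (Eventually.of_forall fun _ => sq_nonneg _)]
    exact ENNReal.ofReal_le_ofReal (h n)
  filter_upwards [ae_lt_top (Measurable.tsum hm) hlt] with ω hω
  have h0 := ENNReal.tendsto_atTop_zero_of_tsum_ne_top hω.ne
  have h1 := (ENNReal.tendsto_toReal ENNReal.zero_ne_top).comp h0
  have h2 : Tendsto (fun n => X n ω ^ 2) atTop (𝓝 0) := by
    refine h1.congr fun n => ?_
    exact ENNReal.toReal_ofReal (sq_nonneg _)
  have h3 := h2.sqrt
  rw [Real.sqrt_zero] at h3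
  simp only [Real.sqrt_sq_eq_abs] at h3
  exact (tendsto_zero_iff_abs_tendsto_zero _).2 h3

theorem dist_integral_le_dist {Y : Type*} [TopologicalSpace Y] [CompactSpace Y]
    [MeasurableSpace Y] [BorelSpace Y] (μ : Measure Y) [IsProbabilityMeasure μ] (t s : C(Y, ℝ)) :
    dist (∫ y, t y ∂μ) (∫ y, s y ∂μ) ≤ dist t s := by
  rw [Real.dist_eq, ← integral_sub (integrable_continuousMap μ t) (integrable_continuousMap μ s)]
  have := norm_integral_le_of_norm_le_const (μ := μ) (f := fun y => t y - s y)
    (Eventually.of_forall fun y => by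
      rw [← dist_eq_norm]
      exact ContinuousMap.dist_apply_le_dist y)
  rwa [probReal_univ, mul_one] at this

/-- Vague convergence of probability measures can be tested on a dense set of functions. -/
theorem vagueTendsto_of_dense {Y : Type*} [TopologicalSpace Y] [CompactSpace Y]
    [MeasurableSpace Y] [BorelSpace Y] {μ : ℕ → Measure Y} {ν : Measure Y}
    [∀ n, IsProbabilityMeasure (μ n)] [IsProbabilityMeasure ν] {D : Set C(Y, ℝ)} (hD : Dense D)
    (h : ∀ s ∈ D, Tendsto (fun n => ∫ y, s y ∂(μ n)) atTop (𝓝 (∫ y, s y ∂ν))) :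
    VagueTendsto μ ν := by
  intro t
  rw [Metric.tendsto_atTop]
  intro ε hε
  obtain ⟨s, hs, hts⟩ := hD.exists_dist_lt t (show 0 < ε / 3 by positivity)
  obtain ⟨N, hN⟩ := Metric.tendsto_atTop.1 (h s hs) (ε / 3) (by positivity)
  refine ⟨N, fun n hn => ?_⟩
  have h1 := dist_integral_le_dist (μ n) t s
  have h2 := dist_integral_le_dist ν s t
  rw [dist_comm s t] at h2
  have h3 := dist_triangle4 (∫ y, t y ∂(μ n)) (∫ y, s y ∂(μ n)) (∫ y, s y ∂ν) (∫ y, t y ∂ν)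
  linarith [hN n hn]

/-- Almost every sample of an affine-exchangeable measure with the independence property gives a
sequence of functions on finite cubes that converges to the measure. -/
theorem exists_sequence_tendsto {μ : Measure (F2w → B)} [IsProbabilityMeasure μ]
    (hμ : IsAffineExchangeable μ) (hi : HasIndependenceProperty μ) :
    ∃ f : ∀ n : ℕ, DCube n → B, ∀ L : Finset F2w,
      VagueTendsto (fun n => sampleMeasure L (f n)) (μ.map fun b (v : L) => b v) := by
  have hm : ∀ L : Finset F2w, Measurable fun (b : F2w → B) (v : L) => b v := fun L => by fun_prop
  have key : ∀ (L : Finset F2w) (t : C(L → B, ℝ)), ∀ᵐ b ∂μ,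
      Tendsto (fun n => ∫ y, t y ∂(sampleMeasure L fun v : DCube n => b (embedCube n v))) atTop
        (𝓝 (∫ y, t y ∂(μ.map fun b (v : L) => b v))) := by
    intro L t
    obtain ⟨k, hk⟩ := exists_support_subset_range fun v : L => (v : F2w)
    set c := ∫ y, t y ∂(μ.map fun b (v : L) => b v) with hc
    let s : C(L → B, ℝ) := t - ContinuousMap.const _ c
    have hs : ∫ b, s (fun v => b v) ∂μ = 0 := by
      rw [integral_map (hm L).aemeasurable t.continuous.measurable.aestronglyMeasurable] at hc
      change ∫ b, (cylinderMap (fun v : L => (v : F2w)) t b - c) ∂μ = 0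
      rw [integral_sub (integrable_continuousMap μ _) (integrable_const c), integral_const,
        probReal_univ, one_smul, sub_eq_zero]
      exact hc.symm
    have hcont := continuous_cubeAverage (B := B) (fun v : L => (v : F2w)) k
    have hsum : Summable fun n : ℕ => ‖s‖ ^ 2 * ((2 : ℝ) ^ (2 * k + 1) / 2 ^ n) := by
      simp only [div_eq_mul_inv, ← inv_pow]
      exact ((summable_geometric_of_lt_one (by norm_num) (by norm_num)).mul_left _).mul_left _
    filter_upwards [ae_tendsto_zero_of_integral_sq_le (μ := μ)
      (fun n => (hcont n s).measurable)
      (fun n => integrable_continuousMap μ ⟨_, (hcont n s).pow 2⟩) hsum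
      (integral_cubeAverage_sq_le hμ hi (fun v : L => (v : F2w)) hk s hs)] with b hb
    have hb' := hb.add_const c
    rw [zero_add] at hb'
    refine hb'.congr fun n => ?_
    rw [integral_sampleMeasure (fun v hv => hk ⟨v, hv⟩)]
    simp only [cubeAverage, s, ContinuousMap.sub_apply, ContinuousMap.const_apply,
      Finset.expect_sub_distrib, Fintype.expect_const, sub_add_cancel]
  -- There are countably many `L`, and each `C(L → B, ℝ)` is separable, so one null set serves for
  -- all.
  have hall : ∀ᵐ b ∂μ, ∀ (L : Finset F2w) (j : ℕ),
      Tendsto (fun n => ∫ y, TopologicalSpace.denseSeq C(L → B, ℝ) j y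
        ∂(sampleMeasure L fun v : DCube n => b (embedCube n v))) atTop
        (𝓝 (∫ y, TopologicalSpace.denseSeq C(L → B, ℝ) j y ∂(μ.map fun b (v : L) => b v))) :=
    ae_all_iff.2 fun L => ae_all_iff.2 fun j => key L _
  obtain ⟨b, hb⟩ := hall.exists
  refine ⟨fun n v => b (embedCube n v), fun L => ?_⟩
  have := Measure.isProbabilityMeasure_map (μ := μ) (hm L).aemeasurable
  refine vagueTendsto_of_dense (TopologicalSpace.denseRange_denseSeq C(L → B, ℝ)) ?_
  rintro _ ⟨j, rfl⟩
  exact hb L j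

/-- A measure on `B^{𝔽₂^ω}` whose marginals are vague limits of the same probability measures as
those of a probability measure is equal to it. -/
theorem eq_of_vagueTendsto_marginals {μ ν : Measure (F2w → B)} [IsProbabilityMeasure μ]
    {σ : ∀ L : Finset F2w, ℕ → Measure (L → B)}
    (hμ : ∀ L, VagueTendsto (σ L) (μ.map fun b (v : L) => b v))
    (hν : ∀ L, VagueTendsto (σ L) (ν.map fun b (v : L) => b v)) : μ = ν := by
  have hm : ∀ L : Finset F2w, Measurable fun (b : F2w → B) (v : L) => b v := fun L => by fun_prop
  have h : ∀ (L : Finset F2w) (t : C(L → B, ℝ)),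
      ∫ b, t (fun v => b v) ∂μ = ∫ b, t (fun v => b v) ∂ν := fun L t => by
    have := tendsto_nhds_unique (hμ L t) (hν L t)
    rwa [integral_map (hm L).aemeasurable t.continuous.measurable.aestronglyMeasurable,
      integral_map (hm L).aemeasurable t.continuous.measurable.aestronglyMeasurable] at this
  -- Finiteness of `ν` is derived rather than assumed: the empty marginal tested on `1` gives real
  -- mass `1`, whereas infinite mass would read as `0`.
  have hone : ν.real Set.univ = 1 := by
    simpa using (h ∅ 1).symm
  have : IsFiniteMeasure ν := ⟨by
    rw [lt_top_iff_ne_top]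
    intro htop
    simp [Measure.real, htop] at hone⟩
  exact measure_ext_of_integral_cylinder h

end Concentration

/-! ### The equivalence -/

theorem mainTheorem9 {X : Type*} [TopologicalSpace X] [MeasurableSpace X] [BorelSpace X]
    [Cubespace X] [IsCompactNilspace X] (hX : IsProfiniteStep X) (hX2 : IsTwoHomogeneous X)
    {B : Type*} [MetricSpace B] [CompactSpace B] [MeasurableSpace B] [BorelSpace B] :
    Represents X B ↔ IsLimitDomain X B := by
  constructor
  · intro h f hf
    obtain ⟨μ, hμ, hexch, hind, hlim⟩ := exists_limit_measure hf
    obtain ⟨m, hm, rfl⟩ := h μ hμ hexch hind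
    exact ⟨m, hm, hlim⟩
  · intro h μ hμ hexch hind
    obtain ⟨f, hf⟩ := exists_sequence_tendsto hexch hind
    obtain ⟨m, hm, hlim⟩ := h f fun L => ⟨_, Measure.isProbabilityMeasure_map
      (Measurable.aemeasurable (by fun_prop)), hf L⟩
    exact ⟨m, hm, eq_of_vagueTendsto_marginals hf hlim⟩
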